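/- For a finite graph $G$ on vertex set $V$ (parallel edges are allowed and have no effect), let $P_G=\operatorname{conv}\{\pm(e_u-e_v): uv\in E(G)\}\subset\mathbb{R}^V$ be its symmetric edge polytope, and let $N(G)$ be the number of facets (faces of dimension $\dim P_G-1$) of $P_G$. Let $C_n$ be the cycle with $n$ edges ($C_2$ being two vertices joined by two parallel edges), and let $G\vee H$ denote any graph obtained from disjoint copies of $G$ and $H$ by identifying one vertex of $G$ with one vertex of $H$. For positive integers $x_1,x_2,x_3$ let $CB(x_1,x_2,x_3)$ be the graph made of three internally disjoint paths of lengths $x_1,x_2,x_3$ connecting two common endpoints (so several $x_i=1$ give parallel edges). For positive integers $m_1,m_2,m_3$ of the same parity, put $s=\min(m_1,m_2,m_3)$ and \[ F(m_1,m_2,m_3)=\sum_{j=0}^{s}\ \prod_{k=1}^{3}\binom{m_k}{\tfrac12(m_k-s)+j}. \] Then, all path lengths below being positive integers, the following hold. (i) If $x_1,x_2,x_3$ are all even or all odd, then $N(CB(x_1,x_2,x_3))=F(x_1,x_2,x_3)$. (ii) If $o_1,o_2$ are odd, $e_1$ is even, and all are at least $2$, then \[N(CB(o_1,o_2,e_1))=e_1F(o_1,o_2,e_1-1)+o_1o_2F(o_1-1,o_2-1,e_1).\]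 If $e_1,e_2$ are even, $o_1$ is odd, and all are at least $2$, then \[N(CB(e_1,e_2,o_1))=o_1F(e_1,e_2,o_1-1)+e_1e_2F(e_1-1,e_2-1,o_1).\] (iii) If $e_1,e_2$ are even, then \[N(CB(e_1,e_2,1))=e_1e_2F(e_1-1,e_2-1,1)+N(C_{e_1}\vee C_{e_2}).\] (iv) If $e_1$ is even and $o_1\ge 3$ is odd, then \[N(CB(e_1,o_1,1))=e_1F(e_1-1,o_1,1)+o_1N(C_{o_1-1}\vee C_{e_1}).\] (v) If $e_1$ is even, then \[N(CB(e_1,1,1))=e_1F(e_1-1,1,1)+N(C_{e_1}).\] In (iii) and (iv) the formula holds for every choice of the identified vertices. -/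

import Mathlib

open scoped Graph

namespace SymEdge

/-- The symmetric edge polytope of a (multi)graph: the convex hull of the vectors
`± (e_x - e_y)` over all edges `xy`.  As `IsLink` is symmetric in `x` and `y`, both signs
occur in the set below. -/
def polytope {α β : Type*} [DecidableEq α] (G : Graph α β) : Set (α → ℝ) :=
  convexHull ℝ {p | ∃ e x y, G.IsLink e x y ∧ p = Pi.single x 1 - Pi.single y 1}

/-- `A` is a facet of `P`: a nonempty (exposed) face of dimension `dim P - 1`. -/
def IsFacet {α : Type*} (P A : Set (α → ℝ)) : Prop :=
  A.Nonempty ∧ IsExposed ℝ P A ∧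
    Module.finrank ℝ (vectorSpan ℝ A) + 1 = Module.finrank ℝ (vectorSpan ℝ P)

/-- `N(G)`: the number of facets of the symmetric edge polytope of `G`. -/
noncomputable def numFacets {α β : Type*} [DecidableEq α] (G : Graph α β) : ℕ :=
  {A : Set (α → ℝ) | IsFacet (polytope G) A}.ncard

/-- The multigraph with vertex set `α` and edge set `β` (all of both types) in which the
edge `e` has the two ends `(ends e).1` and `(ends e).2`. -/
def ofEnds {α β : Type*} (ends : β → α × α) : Graph α β where
  vertexSet := Set.univ
  IsLink e x y := ends e = (x, y) ∨ ends e = (y, x)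
  edgeSet := Set.univ
  isLink_symm _ _ := ⟨fun _ _ h => h.symm⟩
  eq_or_eq_of_isLink_of_isLink := by
    intro e x y v w h h'
    rcases h with h | h <;> rcases h' with h' | h' <;> simp_all
  edge_mem_iff_exists_isLink e := by
    simp only [Set.mem_univ, true_iff]
    exact ⟨(ends e).1, (ends e).2, Or.inl rfl⟩
  left_mem_of_isLink := by
    intro e x y _
    trivial

/-- The cycle `C_n` with `n` edges; `C_2` consists of two parallel edges. -/
def cycle (n : ℕ) : Graph (Fin n) (Fin n) :=
  ofEnds fun i => (i, finRotate n i)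

/-- The vertices of `CB(m)`: the two endpoints (`Sum.inl false` and `Sum.inl true`), and the
`m k - 1` internal vertices of the `k`-th path. -/
abbrev CBVertex {t : ℕ} (m : Fin t → ℕ) : Type :=
  Bool ⊕ (Σ k : Fin t, Fin (m k - 1))

/-- The vertex at distance `i` from the first endpoint along the `k`-th path, for `i ≤ m k`. -/
def cbPos {t : ℕ} (m : Fin t → ℕ) (k : Fin t) (i : ℕ) : CBVertex m :=
  if i = 0 then Sum.inl false
  else if h : i - 1 < m k - 1 then Sum.inr ⟨k, ⟨i - 1, h⟩⟩
  else Sum.inl true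

/-- `CB(m)`: `t` internally disjoint paths of lengths `m 0, …, m (t - 1)` (all positive)
connecting two endpoints.  Several paths of length `1` give parallel edges. -/
def CB {t : ℕ} (m : Fin t → ℕ) : Graph (CBVertex m) (Σ k : Fin t, Fin (m k)) :=
  ofEnds fun e => (cbPos m e.1 (e.2 : ℕ), cbPos m e.1 ((e.2 : ℕ) + 1))

/-- The map that places the vertices of the second graph in the wedge, sending `v` to `u`. -/
def wedgeMap {α γ : Type*} [DecidableEq γ] (u : α) (v w : γ) : α ⊕ {w : γ // w ≠ v} :=
  if h : w = v then Sum.inl u else Sum.inr ⟨w, h⟩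

/-- The wedge `G ∨ H`: the disjoint union of `G` and `H` with the vertex `u` of `G` and the
vertex `v` of `H` identified. -/
def wedge {α β γ δ : Type*} [DecidableEq γ] (G : Graph α β) (u : α) (H : Graph γ δ) (v : γ) :
    Graph (α ⊕ {w : γ // w ≠ v}) (β ⊕ δ) where
  vertexSet := Sum.inl '' V(G) ∪ wedgeMap u v '' V(H)
  IsLink e x y := match e with
    | Sum.inl e => ∃ a b, G.IsLink e a b ∧ x = Sum.inl a ∧ y = Sum.inl b
    | Sum.inr e => ∃ a b, H.IsLink e a b ∧ x = wedgeMap u v a ∧ y = wedgeMap u v b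
  isLink_symm := by
    rintro (e | e) - <;> refine ⟨?_⟩ <;> rintro x y ⟨a, b, h, hx, hy⟩ <;>
      exact ⟨b, a, h.symm, hy, hx⟩
  eq_or_eq_of_isLink_of_isLink := by
    rintro (e | e) x y z w ⟨a, b, h, rfl, rfl⟩ ⟨c, d, h', rfl, rfl⟩ <;>
      rcases h.left_eq_or_eq h' with rfl | rfl <;> simp
  left_mem_of_isLink := by
    rintro (e | e) x y ⟨a, b, h, rfl, rfl⟩
    · exact Or.inl ⟨a, h.left_mem, rfl⟩
    · exact Or.inr ⟨a, h.left_mem, rfl⟩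

/-- `F(m) = ∑_{j=0}^{s} ∏_k binom(m_k, (m_k - s)/2 + j)` with `s` the smallest entry of `m`, for
vectors `m` whose entries all have the same parity.  The factor of a smallest entry is
`binom(s, j)`, and no sorting of the entries is needed as the product is symmetric. -/
def F {t : ℕ} (m : Fin (t + 1) → ℕ) : ℕ :=
  let s := Finset.univ.inf' Finset.univ_nonempty m
  ∑ j ∈ Finset.range (s + 1), ∏ k, (m k).choose ((m k - s) / 2 + j)

end SymEdge

/-! For connected `G`, a facet of the polytope lies on a hyperplane `l = 1`, and the values of `l`
on the unit vectors, normalised at a root, form an integer potential. It changes by at most one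
along each edge, and its tight edges (change exactly one) connect all vertices. This gives a
bijection, `numFacets_eq_ncard`.

On `CB m` a potential amounts to steps in {-1, 0, 1} along each path with a common sum `D`. The
tight edges connect everything exactly when each path has at most one zero step and some path has
none (`numFacets_CB`). A zero step on path `k` can sit in `m k` places, and deleting it leaves a
sign sequence of length `m k - 1`. Sign sequences are counted by binomials, and summing their
products over `D` gives `F` (`sum_prod_card_stepSet`). Sums of signs have the parity of the length,
so a zero pattern contributes only if the shortened lengths agree mod 2: one pattern survives in
(i), two in the other cases.

Even cycles and their wedges are bipartite, which makes every edge tight. Their counts are products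
of central binomials, and these are the values of `F` when a path of length 1 has been shortened to
length 0. -/

namespace SymEdge

open Submodule Relation

/-! ### Facets of centrally symmetric convex hulls. -/

section Polytope

variable {α : Type*}

/-- The hyperplane `l = 1` misses the origin, so a point of `A` is independent of the differences.
This turns the affine dimension in `IsFacet` into a linear one. -/
theorem finrank_span_eq_finrank_vectorSpan_add_one [Finite α] {A : Set (α → ℝ)}
    {l : (α → ℝ) →ₗ[ℝ] ℝ} (hl : ∀ a ∈ A, l a = 1) (hA : A.Nonempty) :
    Module.finrank ℝ (span ℝ A) = Module.finrank ℝ (vectorSpan ℝ A) + 1 := by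
  obtain ⟨t, ht⟩ := hA
  have hker : vectorSpan ℝ A ≤ LinearMap.ker l := by
    rw [vectorSpan_def, span_le]
    rintro _ ⟨a, ha, b, hb, rfl⟩
    simp [hl a ha, hl b hb]
  have ht' : t ∉ vectorSpan ℝ A := fun h => by
    have := hker h
    simp [hl t ht] at this
  rw [← finrank_sup_span_singleton ht']
  refine congrArg (fun S : Submodule ℝ (α → ℝ) => Module.finrank ℝ S) ?_
  apply le_antisymm
  · rw [span_le]
    intro a ha
    have h1 : a - t ∈ vectorSpan ℝ A := vsub_mem_vectorSpan ℝ ha ht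
    have h2 := add_mem_sup h1 (mem_span_singleton_self (R := ℝ) t)
    simpa using h2
  · rw [sup_le_iff, vectorSpan_def, span_le, span_singleton_le_iff_mem]
    refine ⟨?_, subset_span ht⟩
    rintro _ ⟨a, ha, b, hb, rfl⟩
    exact sub_mem (subset_span ha) (subset_span hb)

/-- By symmetry each generator is half of the difference `v - -v`. -/
theorem vectorSpan_convexHull_of_neg_mem {V : Set (α → ℝ)} (hneg : ∀ v ∈ V, -v ∈ V) :
    vectorSpan ℝ (convexHull ℝ V) = span ℝ V := by
  rw [← direction_affineSpan, affineSpan_convexHull, direction_affineSpan, vectorSpan_def]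
  apply le_antisymm
  · rw [span_le]
    rintro _ ⟨a, ha, b, hb, rfl⟩
    exact sub_mem (subset_span ha) (subset_span hb)
  · rw [span_le]
    intro v hv
    have h : v - -v ∈ span ℝ (V -ᵥ V) := subset_span ⟨v, hv, -v, hneg v hv, rfl⟩
    have h2 := smul_mem _ (2⁻¹ : ℝ) h
    have h3 : (2⁻¹ : ℝ) • (v - -v) = v := by
      rw [sub_neg_eq_add, ← two_smul ℝ v, smul_smul]
      norm_num
    rwa [h3] at h2

theorem convexHull_subset_span (V : Set (α → ℝ)) : convexHull ℝ V ⊆ span ℝ V :=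
  convexHull_min subset_span (span ℝ V).convex

theorem le_on_convexHull {V : Set (α → ℝ)} {l : (α → ℝ) →ₗ[ℝ] ℝ} {c : ℝ}
    (hl : ∀ v ∈ V, l v ≤ c) {p : α → ℝ} (hp : p ∈ convexHull ℝ V) : l p ≤ c :=
  convexHull_min (t := {p | l p ≤ c}) hl (convex_halfSpace_le l.isLinear c) hp

theorem isFacet_of_span_eq [Finite α] {V : Set (α → ℝ)} (hneg : ∀ v ∈ V, -v ∈ V)
    {l : (α → ℝ) →ₗ[ℝ] ℝ} (hl : ∀ v ∈ V, l v ≤ 1) (hne : ∃ v ∈ V, l v = 1)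
    (hspan : V ⊆ span ℝ {v ∈ V | l v = 1}) :
    IsFacet (convexHull ℝ V) {p ∈ convexHull ℝ V | l p = 1} := by
  obtain ⟨t, ht, ht1⟩ := hne
  have htA : t ∈ {p ∈ convexHull ℝ V | l p = 1} := ⟨subset_convexHull ℝ V ht, ht1⟩
  refine ⟨⟨t, htA⟩, ?_, ?_⟩
  · refine fun _ => ⟨LinearMap.toContinuousLinearMap l, ?_⟩
    ext p
    simp only [Set.mem_ofPred_eq, LinearMap.coe_toContinuousLinearMap']
    refine and_congr_right fun hp => ⟨fun h y hy => h ▸ le_on_convexHull hl hy, fun h => ?_⟩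
    exact le_antisymm (le_on_convexHull hl hp) (ht1 ▸ h t htA.1)
  · rw [vectorSpan_convexHull_of_neg_mem hneg,
      ← finrank_span_eq_finrank_vectorSpan_add_one (fun a ha => ha.2) ⟨t, htA⟩]
    refine congrArg (fun S : Submodule ℝ (α → ℝ) => Module.finrank ℝ S) ?_
    apply le_antisymm
    · rw [span_le]
      exact fun a ha => convexHull_subset_span V ha.1
    · rw [span_le]
      refine hspan.trans (span_mono ?_)
      exact fun v hv => ⟨subset_convexHull ℝ V hv.1, hv.2⟩

/-- The maximum of a supporting functional is positive by symmetry, so it can be scaled to one; the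
dimension count then forces equality of spans. -/
theorem IsFacet.exists_functional [Finite α] {V A : Set (α → ℝ)} (hneg : ∀ v ∈ V, -v ∈ V)
    (hA : IsFacet (convexHull ℝ V) A) :
    ∃ l : (α → ℝ) →ₗ[ℝ] ℝ, (∀ v ∈ V, l v ≤ 1) ∧ A = {p ∈ convexHull ℝ V | l p = 1} ∧
      span ℝ A = span ℝ V := by
  obtain ⟨hne, hexp, hdim⟩ := hA
  obtain ⟨l, hl⟩ := hexp hne
  obtain ⟨a, ha⟩ := hne
  have haP := ha
  rw [hl] at haP
  have hle : ∀ v ∈ V, l v ≤ l a := fun v hv => haP.2 v (subset_convexHull ℝ V hv)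
  have hle' : ∀ p ∈ convexHull ℝ V, l p ≤ l a := haP.2
  have hlA : A = {p ∈ convexHull ℝ V | l p = l a} := by
    rw [hl]
    ext p
    refine and_congr_right fun hp => ⟨fun h => le_antisymm (hle' p hp) (h a haP.1), fun h y hy => ?_⟩
    rw [h]
    exact hle' y hy
  have hnegP : ∀ p ∈ convexHull ℝ V, -p ∈ convexHull ℝ V := by
    intro p hp
    have h := Set.neg_mem_neg.2 hp
    rw [← convexHull_neg] at h
    refine convexHull_mono ?_ h
    intro v hv
    simpa using hneg _ hv
  -- A nonpositive maximum would make `l` constant on the symmetric polytope, so the face would be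
  -- the whole polytope, of too large a dimension.
  have hc : 0 < l a := by
    by_contra hc
    have hzero : ∀ p ∈ convexHull ℝ V, l p = l a := by
      intro p hp
      have h1 := hle' p hp
      have h2 := hle' _ (hnegP p hp)
      rw [map_neg] at h2
      linarith
    have hAP : A = convexHull ℝ V := by
      rw [hlA]
      ext p
      exact ⟨fun h => h.1, fun h => ⟨h, hzero p h⟩⟩
    rw [hAP] at hdim
    omega
  have hA1 : A = {p ∈ convexHull ℝ V | ((l a)⁻¹ • (l : (α → ℝ) →ₗ[ℝ] ℝ)) p = 1} := by
    rw [hlA]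
    ext p
    refine and_congr_right fun _ => ?_
    simp only [LinearMap.smul_apply, ContinuousLinearMap.coe_coe, smul_eq_mul]
    rw [inv_mul_eq_one₀ hc.ne', eq_comm]
  refine ⟨(l a)⁻¹ • (l : (α → ℝ) →ₗ[ℝ] ℝ), ?_, hA1, ?_⟩
  · intro v hv
    simp only [LinearMap.smul_apply, ContinuousLinearMap.coe_coe, smul_eq_mul]
    rw [inv_mul_le_one₀ hc]
    exact hle v hv
  · refine Submodule.eq_of_le_of_finrank_eq ?_ ?_
    · rw [span_le, hlA]
      exact fun a ha => convexHull_subset_span V ha.1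
    · rw [← vectorSpan_convexHull_of_neg_mem hneg, ← hdim]
      refine finrank_span_eq_finrank_vectorSpan_add_one
        (l := (l a)⁻¹ • (l : (α → ℝ) →ₗ[ℝ] ℝ)) (fun b hb => ?_) ⟨a, ha⟩
      rw [hA1] at hb
      exact hb.2

/-- A convex combination attains the bound 1 only if every generator of positive weight does. -/
theorem eq_zero_of_eq_one_of_mem_convexHull {V : Set (α → ℝ)} {l h : (α → ℝ) →ₗ[ℝ] ℝ}
    (hl : ∀ v ∈ V, l v ≤ 1) (hh : ∀ v ∈ V, l v = 1 → h v = 0) {p : α → ℝ}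
    (hp : p ∈ convexHull ℝ V) (hp1 : l p = 1) : h p = 0 := by
  obtain ⟨ι, _, w, z, hw, hw1, hz, rfl⟩ := mem_convexHull_iff_exists_fintype.1 hp
  have hsum : ∑ i, w i * (1 - l (z i)) = 0 := by
    simp only [map_sum, map_smul, smul_eq_mul] at hp1
    simp only [mul_sub, mul_one, Finset.sum_sub_distrib, hw1, hp1, sub_self]
  rw [Finset.sum_eq_zero_iff_of_nonneg
    fun i _ => mul_nonneg (hw i) (sub_nonneg.2 (hl _ (hz i)))] at hsum
  simp only [map_sum, map_smul, smul_eq_mul]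
  refine Finset.sum_eq_zero fun i hi => ?_
  rcases mul_eq_zero.1 (hsum i hi) with h0 | h0
  · simp [h0]
  · simp [hh _ (hz i) (by linarith)]

end Polytope

/-! ### Facets as integer potentials. -/

section Facets

variable {α β : Type*}

/-- Integer potentials on the vertices that describe the facets of the symmetric edge polytope:
they vanish at the root, vary by at most one along each edge, and the edges along which they
vary connect the root to every vertex. -/
structure IsFacetPotential (G : Graph α β) (r : α) (f : α → ℤ) : Prop where
  root : f r = 0
  abs_le : ∀ x y, G.Adj x y → |f x - f y| ≤ 1
  reach : ∀ x, ReflTransGen (fun x y => G.Adj x y ∧ |f x - f y| = 1) r x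

variable [DecidableEq α]

/-- The vertices of the symmetric edge polytope. -/
def edgeVectors (G : Graph α β) : Set (α → ℝ) :=
  {p | ∃ e x y, G.IsLink e x y ∧ p = Pi.single x 1 - Pi.single y 1}

theorem neg_mem_edgeVectors (G : Graph α β) : ∀ v ∈ edgeVectors G, -v ∈ edgeVectors G := by
  rintro _ ⟨e, x, y, h, rfl⟩
  exact ⟨e, y, x, h.symm, by simp⟩

theorem mem_edgeVectors {G : Graph α β} {x y : α} (h : G.Adj x y) :
    (Pi.single x 1 - Pi.single y 1 : α → ℝ) ∈ edgeVectors G := by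
  obtain ⟨e, he⟩ := h
  exact ⟨e, x, y, he, rfl⟩

variable [Fintype α]

/-- The linear functional with the given values on the unit vectors. -/
noncomputable def dot (f : α → ℝ) : (α → ℝ) →ₗ[ℝ] ℝ := Fintype.linearCombination ℝ f

theorem dot_edge (f : α → ℝ) (x y : α) :
    dot f (Pi.single x 1 - Pi.single y 1) = f x - f y := by
  simp [dot, Fintype.linearCombination_apply_single]

/-- The face of the polytope on which the functional with values `f` equals one. -/
def potentialFace (G : Graph α β) (f : α → ℤ) : Set (α → ℝ) :=
  {p ∈ polytope G | dot (fun x => (f x : ℝ)) p = 1}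

theorem dot_intCast_edge_eq_one (f : α → ℤ) (x y : α) :
    dot (fun x => (f x : ℝ)) (Pi.single x 1 - Pi.single y 1) = 1 ↔ f x - f y = 1 := by
  rw [dot_edge]
  norm_cast

/-- Adding up signed tight edges along a walk from the root puts every `e_x - e_r` in the span of
the face, hence every edge vector too. -/
theorem IsFacetPotential.isFacet [Nontrivial α] {G : Graph α β} {r : α} {f : α → ℤ}
    (hf : IsFacetPotential G r f) : IsFacet (polytope G) (potentialFace G f) := by
  have hstep : ∀ x y, G.Adj x y → |f x - f y| = 1 → (Pi.single x 1 - Pi.single y 1 : α → ℝ) ∈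
      span ℝ {v ∈ edgeVectors G | dot (fun x => (f x : ℝ)) v = 1} := by
    intro x y h hxy
    rcases (abs_eq zero_le_one).1 hxy with h1 | h1
    · exact subset_span ⟨mem_edgeVectors h, (dot_intCast_edge_eq_one f x y).2 h1⟩
    · rw [← neg_sub]
      refine neg_mem (subset_span ⟨mem_edgeVectors h.symm, (dot_intCast_edge_eq_one f y x).2 ?_⟩)
      omega
  have hreach : ∀ x, (Pi.single x 1 - Pi.single r 1 : α → ℝ) ∈
      span ℝ {v ∈ edgeVectors G | dot (fun x => (f x : ℝ)) v = 1} := by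
    intro x
    induction hf.reach x with
    | refl => simp
    | @tail y z _ hyz ih =>
      have := sub_mem ih (hstep y z hyz.1 hyz.2)
      simpa using this
  refine isFacet_of_span_eq (neg_mem_edgeVectors G) ?_ ?_ ?_
  · rintro _ ⟨e, x, y, h, rfl⟩
    rw [dot_edge]
    have := (_root_.abs_le.1 (hf.abs_le x y h.adj)).2
    exact_mod_cast this
  · obtain ⟨x, hx⟩ := exists_ne r
    rcases (hf.reach x).cases_head with h | ⟨y, ⟨h, hy⟩, -⟩
    · exact absurd h.symm hx
    · rcases (abs_eq zero_le_one).1 hy with h1 | h1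
      · exact ⟨_, mem_edgeVectors h, (dot_intCast_edge_eq_one f r y).2 h1⟩
      · exact ⟨_, mem_edgeVectors h.symm, (dot_intCast_edge_eq_one f y r).2 (by omega)⟩
  · rintro _ ⟨e, x, y, h, rfl⟩
    have := sub_mem (hreach x) (hreach y)
    simpa using this

/-- The face records the tight edges with their directions, and tight walks from the root determine
the potential. -/
theorem IsFacetPotential.eq_of_potentialFace_eq {G : Graph α β} {r : α} {f g : α → ℤ}
    (hf : IsFacetPotential G r f) (hg : IsFacetPotential G r g)
    (h : potentialFace G f = potentialFace G g) : f = g := by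
  have key : ∀ x y, G.Adj x y → f x - f y = 1 → g x - g y = 1 := by
    intro x y hxy h1
    have hmem : (Pi.single x 1 - Pi.single y 1 : α → ℝ) ∈ potentialFace G f :=
      ⟨subset_convexHull ℝ _ (mem_edgeVectors hxy), (dot_intCast_edge_eq_one f x y).2 h1⟩
    rw [h] at hmem
    exact (dot_intCast_edge_eq_one g x y).1 hmem.2
  ext x
  induction hf.reach x with
  | refl => rw [hf.root, hg.root]
  | @tail y z _ hyz ih =>
    rcases (abs_eq zero_le_one).1 hyz.2 with h1 | h1
    · have := key y z hyz.1 h1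
      omega
    · have := key z y hyz.1.symm (by omega)
      omega

theorem IsFacet.exists_potential {G : Graph α β} {r : α}
    (hconn : ∀ x, ReflTransGen G.Adj r x) {A : Set (α → ℝ)} (hA : IsFacet (polytope G) A) :
    ∃ f, IsFacetPotential G r f ∧ potentialFace G f = A := by
  obtain ⟨l, hl, rfl, hspan⟩ := IsFacet.exists_functional (neg_mem_edgeVectors G) hA
  set g : α → ℝ := fun x => l (Pi.single x 1) - l (Pi.single r 1) with hg
  have hlg : ∀ x y, l (Pi.single x 1 - Pi.single y 1) = g x - g y := by
    intro x y
    simp [hg]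
  have hgle : ∀ x y, G.Adj x y → g x - g y ≤ 1 := by
    intro x y h
    rw [← hlg]
    exact hl _ (mem_edgeVectors h)
  have hreach : ∀ x, ReflTransGen (fun x y => G.Adj x y ∧ |g x - g y| = 1) r x := by
    -- No tight edge leaves `U`, so its indicator functional vanishes on the face, hence on its
    -- span, which contains all edge vectors. So no edge at all leaves `U`.
    set U : Set α := {x | ReflTransGen (fun x y => G.Adj x y ∧ |g x - g y| = 1) r x} with hU
    have hclosed : ∀ x y, G.Adj x y → |g x - g y| = 1 → (x ∈ U ↔ y ∈ U) := by
      intro x y h h1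
      refine ⟨fun hx => hx.tail ⟨h, h1⟩, fun hy => hy.tail ⟨h.symm, ?_⟩⟩
      rw [abs_sub_comm, h1]
    have hzero : ∀ v ∈ span ℝ (edgeVectors G), dot (U.indicator 1) v = 0 := by
      rw [← hspan]
      intro v hv
      have hle : span ℝ {p ∈ convexHull ℝ (edgeVectors G) | l p = 1} ≤
          LinearMap.ker (dot (U.indicator 1)) := by
        rw [span_le]
        rintro p ⟨hp, hp1⟩
        refine eq_zero_of_eq_one_of_mem_convexHull hl ?_ hp hp1
        rintro _ ⟨e, x, y, h, rfl⟩ h1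
        rw [dot_edge]
        rw [hlg] at h1
        have := hclosed x y h.adj (by rw [h1, abs_one])
        by_cases hx : x ∈ U
        · simp [hx, this.1 hx]
        · simp [hx, mt this.2 hx]
      exact hle hv
    intro x
    change x ∈ U
    induction hconn x with
    | refl => exact ReflTransGen.refl
    | @tail y z _ hyz ih =>
      have h0 := hzero _ (subset_span (mem_edgeVectors hyz))
      rw [dot_edge] at h0
      by_contra hz
      simp [ih, hz] at h0
  have hint : ∀ x, ∃ n : ℤ, (n : ℝ) = g x := by
    intro x
    induction hreach x with
    | refl => exact ⟨0, by simp [hg]⟩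
    | @tail y z _ hyz ih =>
      obtain ⟨n, hn⟩ := ih
      rcases (abs_eq zero_le_one).1 hyz.2 with h1 | h1
      · exact ⟨n - 1, by push_cast; linarith⟩
      · exact ⟨n + 1, by push_cast; linarith⟩
  choose f hf using hint
  have habs : ∀ x y, ((|f x - f y| : ℤ) : ℝ) = |g x - g y| := by
    intro x y
    push_cast
    rw [hf, hf]
  refine ⟨f, ⟨?_, ?_, ?_⟩, ?_⟩
  · have h := hf r
    simp only [hg, sub_self] at h
    exact_mod_cast h
  · intro x y h
    have h1 : |g x - g y| ≤ 1 := abs_le.2 ⟨by linarith [hgle y x h.symm], hgle x y h⟩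
    rw [← habs] at h1
    exact_mod_cast h1
  · intro x
    refine ReflTransGen.mono ?_ _ _ (hreach x)
    rintro x y ⟨h, h1⟩
    refine ⟨h, ?_⟩
    rw [← habs] at h1
    exact_mod_cast h1
  -- The potential differs from `l` by a constant on the unit vectors, which is invisible on
  -- differences.
  · have hagree : ∀ p ∈ convexHull ℝ (edgeVectors G), dot (fun x => (f x : ℝ)) p = l p := by
      intro p hp
      have hle : span ℝ (edgeVectors G) ≤
          LinearMap.ker (dot (fun x => (f x : ℝ)) - l) := by
        rw [span_le]
        rintro _ ⟨e, x, y, h, rfl⟩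
        simp only [SetLike.mem_coe, LinearMap.mem_ker, LinearMap.sub_apply, dot_edge, hlg, hf,
          sub_self]
      have := hle (convexHull_subset_span _ hp)
      simpa [sub_eq_zero] using this
    ext p
    refine and_congr_right fun hp => ?_
    rw [hagree p hp]

theorem numFacets_eq_ncard [Nontrivial α] {G : Graph α β} {r : α}
    (hconn : ∀ x, ReflTransGen G.Adj r x) :
    numFacets G = {f : α → ℤ | IsFacetPotential G r f}.ncard := by
  have himage : {A | IsFacet (polytope G) A} =
      potentialFace G '' {f : α → ℤ | IsFacetPotential G r f} := by
    ext A
    constructor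
    · exact fun hA => hA.exists_potential hconn
    · rintro ⟨f, hf, rfl⟩
      exact hf.isFacet
  rw [numFacets, himage]
  exact Set.InjOn.ncard_image fun f hf g hg h => hf.eq_of_potentialFace_eq hg h

end Facets

end SymEdge

namespace SymEdge

open Relation

/-! ### Counting step sequences. -/

section Steps

/-- Sequences of `m` steps in `{-1, 0, 1}` with exactly `z` zero steps and with sum `D`. -/
def stepSet (m z : ℕ) (D : ℤ) : Finset (Fin m → ℤ) :=
  {d ∈ Fintype.piFinset fun _ => {-1, 0, 1} |
    (Finset.univ.filter fun i => d i = 0).card = z ∧ ∑ i, d i = D}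

theorem mem_stepSet {m z : ℕ} {D : ℤ} {d : Fin m → ℤ} :
    d ∈ stepSet m z D ↔ (∀ i, |d i| ≤ 1) ∧
      (Finset.univ.filter fun i => d i = 0).card = z ∧ ∑ i, d i = D := by
  rw [stepSet, Finset.mem_filter, Fintype.mem_piFinset]
  refine and_congr_left fun _ => forall_congr' fun i => ?_
  rw [abs_le]
  simp only [Finset.mem_insert, Finset.mem_singleton]
  omega

theorem mem_stepSet_zero {m : ℕ} {D : ℤ} {d : Fin m → ℤ} :
    d ∈ stepSet m 0 D ↔ (∀ i, |d i| = 1) ∧ ∑ i, d i = D := by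
  rw [mem_stepSet, Finset.card_eq_zero, Finset.filter_eq_empty_iff, ← and_assoc]
  refine and_congr_left fun _ => ⟨fun h i => ?_, fun h => ⟨fun i => (h i).le, fun i _ h0 => ?_⟩⟩
  · exact le_antisymm (h.1 i) (Int.one_le_abs (h.2 (Finset.mem_univ i)))
  · simpa [h0] using h i

theorem abs_le_of_mem_stepSet {m z : ℕ} {D : ℤ} {d : Fin m → ℤ} (hd : d ∈ stepSet m z D) :
    |D| ≤ m := by
  obtain ⟨h1, -, rfl⟩ := mem_stepSet.1 hd
  refine (Finset.abs_sum_le_sum_abs _ _).trans ?_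
  simpa using Finset.sum_le_card_nsmul Finset.univ (fun i => |d i|) 1 fun i _ => h1 i

/-- The sequence of steps that is `1` on `S` and `-1` elsewhere. -/
def signSeq {m : ℕ} (S : Finset (Fin m)) (i : Fin m) : ℤ := if i ∈ S then 1 else -1

theorem sum_signSeq {m : ℕ} (S : Finset (Fin m)) : ∑ i, signSeq S i = 2 * S.card - m := by
  have h : ∀ i, signSeq S i = 2 * (if i ∈ S then 1 else 0) - 1 := by
    intro i
    unfold signSeq
    split_ifs <;> norm_num
  simp only [h, Finset.sum_sub_distrib, ← Finset.mul_sum]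
  simp

theorem exists_signSeq {m : ℕ} {D : ℤ} {d : Fin m → ℤ} (hd : d ∈ stepSet m 0 D) :
    ∃ S, signSeq S = d ∧ D = 2 * S.card - m := by
  rw [mem_stepSet_zero] at hd
  have h : signSeq (Finset.univ.filter fun i => d i = 1) = d := by
    ext i
    have := (abs_eq zero_le_one).1 (hd.1 i)
    simp only [signSeq, Finset.mem_filter, Finset.mem_univ, true_and]
    split_ifs <;> omega
  exact ⟨_, h, by rw [← sum_signSeq, h, hd.2]⟩

/-- Here `j` is the number of `+1` steps. -/
theorem card_stepSet_zero (m j : ℕ) : (stepSet m 0 (2 * j - m)).card = m.choose j := by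
  have h : stepSet m 0 (2 * j - m) = (Finset.powersetCard j Finset.univ).image signSeq := by
    ext d
    rw [Finset.mem_image]
    constructor
    · intro hd
      obtain ⟨S, hS, hD⟩ := exists_signSeq hd
      exact ⟨S, Finset.mem_powersetCard.2 ⟨Finset.subset_univ _, by omega⟩, hS⟩
    · rintro ⟨S, hS, rfl⟩
      rw [mem_stepSet_zero, sum_signSeq, (Finset.mem_powersetCard.1 hS).2]
      refine ⟨fun i => ?_, rfl⟩
      unfold signSeq
      split_ifs <;> rfl
  rw [h, Finset.card_image_of_injective, Finset.card_powersetCard, Finset.card_fin]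
  intro S T hST
  ext i
  have := congrFun hST i
  unfold signSeq at this
  split_ifs at this with h1 h2 <;> simp_all

theorem even_add_of_stepSet_nonempty {m : ℕ} {D : ℤ} (h : (stepSet m 0 D).Nonempty) :
    Even (D + m) := by
  obtain ⟨d, hd⟩ := h
  obtain ⟨S, -, hD⟩ := exists_signSeq hd
  exact ⟨S.card, by omega⟩

/-- Deleting the unique zero keeps the sum, and its position is free. -/
theorem card_stepSet_one (m : ℕ) (D : ℤ) :
    (stepSet (m + 1) 1 D).card = (m + 1) * (stepSet m 0 D).card := by
  have hz : ∀ (p : Fin (m + 1)) (d : Fin m → ℤ), (∀ i, d i ≠ 0) →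
      (Finset.univ.filter fun i => p.insertNth (α := fun _ => ℤ) 0 d i = 0) = {p} := by
    intro p d hd
    ext i
    rcases Fin.eq_self_or_eq_succAbove p i with rfl | ⟨j, rfl⟩
    · simp
    · simp [hd, Fin.succAbove_ne]
  have h : stepSet (m + 1) 1 D = ((Finset.univ : Finset (Fin (m + 1))) ×ˢ stepSet m 0 D).image
      fun x => x.1.insertNth (α := fun _ => ℤ) 0 x.2 := by
    ext d
    simp only [Finset.mem_image, Finset.mem_product, Finset.mem_univ, true_and, Prod.exists]
    constructor
    · intro hd
      obtain ⟨h1, h2, h3⟩ := mem_stepSet.1 hd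
      obtain ⟨p, hp⟩ := Finset.card_eq_one.1 h2
      have hp0 : ∀ i, d i = 0 ↔ i = p := by
        intro i
        have := Finset.ext_iff.1 hp i
        simpa using this
      refine ⟨p, p.removeNth d, mem_stepSet_zero.2 ⟨fun i => ?_, ?_⟩, ?_⟩
      · have hne : d (p.succAbove i) ≠ 0 := fun h => Fin.succAbove_ne p i ((hp0 _).1 h)
        have := abs_pos.2 hne
        have := h1 (p.succAbove i)
        simp only [Fin.removeNth]
        omega
      · rw [Fin.sum_univ_succAbove d p, (hp0 p).2 rfl, zero_add] at h3
        exact h3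
      · rw [← (hp0 p).2 rfl]
        exact Fin.insertNth_self_removeNth p d
    · rintro ⟨p, d, hd, rfl⟩
      obtain ⟨h1, h2⟩ := mem_stepSet_zero.1 hd
      have hne : ∀ i, d i ≠ 0 := fun i h => by simpa [h] using h1 i
      refine mem_stepSet.2 ⟨fun i => ?_, ?_, ?_⟩
      · rcases Fin.eq_self_or_eq_succAbove p i with rfl | ⟨j, rfl⟩
        · simp
        · simp [h1]
      · rw [hz p d hne, Finset.card_singleton]
      · rw [Fin.sum_univ_succAbove _ p]
        simpa using h2
  rw [h, Finset.card_image_of_injOn, Finset.card_product, Finset.card_fin]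
  rintro ⟨p, d⟩ hd ⟨q, e⟩ he hde
  simp only [Finset.coe_product, Set.mem_prod, Finset.mem_coe] at hd he
  have hd0 : ∀ i, d i ≠ 0 := fun i h => by simpa [h] using (mem_stepSet_zero.1 hd.2).1 i
  have he0 : ∀ i, e i ≠ 0 := fun i h => by simpa [h] using (mem_stepSet_zero.1 he.2).1 i
  have hpq := hz p d hd0
  simp only at hde
  rw [hde, hz q e he0, Finset.singleton_inj] at hpq
  subst hpq
  rw [Fin.insertNth_injective2.right _ hde]

/-- The sum of the first `l` terms of a finite sequence. -/
def psum {m : ℕ} (d : Fin m → ℤ) (l : ℕ) : ℤ := ∑ i ∈ Finset.univ.filter fun i : Fin m => (i : ℕ) < l, d i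

theorem psum_zero {m : ℕ} (d : Fin m → ℤ) : psum d 0 = 0 := by simp [psum]

theorem psum_self {m : ℕ} (d : Fin m → ℤ) : psum d m = ∑ i, d i := by simp [psum]

theorem psum_succ {m : ℕ} (d : Fin m → ℤ) (i : Fin m) :
    psum d ((i : ℕ) + 1) = psum d i + d i := by
  have h : (Finset.univ.filter fun j : Fin m => (j : ℕ) < i + 1) =
      insert i (Finset.univ.filter fun j : Fin m => (j : ℕ) < i) := by
    ext j
    simp only [Finset.mem_filter, Finset.mem_univ, true_and, Finset.mem_insert, Fin.ext_iff]
    omega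
  rw [psum, psum, h, Finset.sum_insert (by simp), add_comm]

end Steps

/-! ### Bipartite graphs and wedges. -/

section Bipartite

variable {α β γ δ : Type*}

/-- Potentials that vanish at the root and vary by exactly one along each edge. -/
def tightPotentials (G : Graph α β) (r : α) : Set (α → ℤ) :=
  {f | f r = 0 ∧ ∀ x y, G.Adj x y → |f x - f y| = 1}

/-- The parity of `c` is a 2-colouring. Both `f` and `c` change parity along tight edges, which
reach everything, so `f` agrees mod 2 with `c - c r`. Thus `f` changes by an odd amount on every
edge, that is, by exactly one. -/
theorem setOf_isFacetPotential_eq {G : Graph α β} {r : α} (hconn : ∀ x, ReflTransGen G.Adj r x)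
    {c : α → ℤ} (hc : ∀ x y, G.Adj x y → Odd (c x - c y)) :
    {f | IsFacetPotential G r f} = tightPotentials G r := by
  ext f
  refine ⟨fun hf => ⟨hf.root, fun x y hxy => ?_⟩, fun hf => ⟨hf.1, fun x y h => (hf.2 x y h).le, ?_⟩⟩
  · have heven : ∀ x, Even (f x - (c x - c r)) := by
      intro x
      induction hf.reach x with
      | refl => simp [hf.root]
      | @tail y z _ hyz ih =>
        obtain ⟨a, ha⟩ := ih
        obtain ⟨b, hb⟩ := hc y z hyz.1
        rcases (abs_eq zero_le_one).1 hyz.2 with h1 | h1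
        · exact ⟨a + b, by omega⟩
        · exact ⟨a + b + 1, by omega⟩
    obtain ⟨a, ha⟩ := heven x
    obtain ⟨a', ha'⟩ := heven y
    obtain ⟨b, hb⟩ := hc x y hxy
    have := abs_le.1 (hf.abs_le x y hxy)
    rw [abs_eq zero_le_one]
    omega
  · intro x
    refine ReflTransGen.mono ?_ _ _ (hconn x)
    exact fun x y h => ⟨h, hf.2 x y h⟩

theorem numFacets_eq_ncard_tightPotentials [DecidableEq α] [Fintype α] [Nontrivial α]
    {G : Graph α β} {r : α} (hconn : ∀ x, ReflTransGen G.Adj r x)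
    {c : α → ℤ} (hc : ∀ x y, G.Adj x y → Odd (c x - c y)) :
    numFacets G = (tightPotentials G r).ncard := by
  rw [numFacets_eq_ncard hconn, setOf_isFacetPotential_eq hconn hc]

variable [DecidableEq γ]

theorem wedgeMap_self (u : α) (v : γ) : wedgeMap u v v = Sum.inl u := by simp [wedgeMap]

theorem wedgeMap_of_ne (u : α) (v : γ) (w : {w : γ // w ≠ v}) :
    wedgeMap u v w = Sum.inr w := by
  simp [wedgeMap, w.2]

theorem wedge_adj_iff {G : Graph α β} {u : α} {H : Graph γ δ} {v : γ} {x y} :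
    (wedge G u H v).Adj x y ↔ (∃ a b, G.Adj a b ∧ x = Sum.inl a ∧ y = Sum.inl b) ∨
      ∃ a b, H.Adj a b ∧ x = wedgeMap u v a ∧ y = wedgeMap u v b := by
  constructor
  · rintro ⟨e | e, a, b, h, hx, hy⟩
    · exact Or.inl ⟨a, b, h.adj, hx, hy⟩
    · exact Or.inr ⟨a, b, h.adj, hx, hy⟩
  · rintro (⟨a, b, ⟨e, h⟩, hx, hy⟩ | ⟨a, b, ⟨e, h⟩, hx, hy⟩)
    · exact ⟨Sum.inl e, a, b, h, hx, hy⟩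
    · exact ⟨Sum.inr e, a, b, h, hx, hy⟩

theorem wedge_connected {G : Graph α β} {u : α} {H : Graph γ δ} {v : γ}
    (hG : ∀ x, ReflTransGen G.Adj u x) (hH : ∀ x, ReflTransGen H.Adj v x) (x) :
    ReflTransGen (wedge G u H v).Adj (Sum.inl u) x := by
  rcases x with a | w
  · exact (hG a).lift _ fun x y h => wedge_adj_iff.2 (Or.inl ⟨x, y, h, rfl, rfl⟩)
  · have : ReflTransGen (wedge G u H v).Adj (wedgeMap u v v) (wedgeMap u v w) :=
      (hH w).lift (wedgeMap u v)
      fun x y h => wedge_adj_iff.2 (Or.inr ⟨x, y, h, rfl, rfl⟩)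
    rwa [wedgeMap_self, wedgeMap_of_ne] at this

/-- The function on the wedge with the given restrictions to the two graphs. -/
def wedgeGlue {R : Type*} {v : γ} (f : α → R) (g : γ → R) : α ⊕ {w : γ // w ≠ v} → R :=
  Sum.elim f fun w => g w

theorem wedgeGlue_wedgeMap {R : Type*} {u : α} {v : γ} {f : α → R} {g : γ → R} (h : f u = g v)
    (w : γ) : wedgeGlue f g (wedgeMap u v w) = g w := by
  by_cases hw : w = v
  · subst hw
    rw [wedgeMap_self]
    exact h
  · exact congrArg _ (wedgeMap_of_ne u v ⟨w, hw⟩)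

theorem ncard_tightPotentials_wedge (G : Graph α β) (u : α) (H : Graph γ δ) (v : γ) :
    (tightPotentials (wedge G u H v) (Sum.inl u)).ncard =
      (tightPotentials G u).ncard * (tightPotentials H v).ncard := by
  rw [← Set.ncard_prod]
  symm
  refine Set.ncard_congr (fun p _ => wedgeGlue p.1 p.2) ?_ ?_ ?_
  · rintro ⟨f, g⟩ ⟨hf, hg⟩
    refine ⟨hf.1, fun x y hxy => ?_⟩
    have huv : f u = g v := hf.1.trans hg.1.symm
    rcases wedge_adj_iff.1 hxy with ⟨a, b, h, rfl, rfl⟩ | ⟨a, b, h, rfl, rfl⟩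
    · exact hf.2 a b h
    · rw [wedgeGlue_wedgeMap huv, wedgeGlue_wedgeMap huv]
      exact hg.2 a b h
  · rintro ⟨f, g⟩ ⟨f', g'⟩ ⟨hf, hg⟩ ⟨hf', hg'⟩ h
    have h1 : f = f' := funext fun a => congrFun h (Sum.inl a)
    have h2 : g = g' := funext fun w => by
      have h3 := congrFun h (wedgeMap u v w)
      simp only at h3 hf hg hf' hg'
      rwa [wedgeGlue_wedgeMap (hf.1.trans hg.1.symm),
        wedgeGlue_wedgeMap (hf'.1.trans hg'.1.symm)] at h3
    rw [h1, h2]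
  · rintro f hf
    refine ⟨(fun a => f (Sum.inl a), fun w => f (wedgeMap u v w)), ⟨⟨hf.1, ?_⟩, ⟨?_, ?_⟩⟩, ?_⟩
    · exact fun a b h => hf.2 _ _ (wedge_adj_iff.2 (Or.inl ⟨a, b, h, rfl, rfl⟩))
    · simp only [wedgeMap_self]
      exact hf.1
    · exact fun a b h => hf.2 _ _ (wedge_adj_iff.2 (Or.inr ⟨a, b, h, rfl, rfl⟩))
    · ext x
      rcases x with a | w
      · rfl
      · exact congrArg f (wedgeMap_of_ne u v w)

theorem numFacets_wedge [DecidableEq α] [Fintype α] [Fintype γ] [Nontrivial α] [Nontrivial γ]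
    {G : Graph α β} {u : α} {H : Graph γ δ} {v : γ}
    (hG : ∀ x, ReflTransGen G.Adj u x) (hH : ∀ x, ReflTransGen H.Adj v x)
    {c : α → ℤ} (hc : ∀ x y, G.Adj x y → Odd (c x - c y))
    {c' : γ → ℤ} (hc' : ∀ x y, H.Adj x y → Odd (c' x - c' y)) :
    numFacets (wedge G u H v) = numFacets G * numFacets H := by
  rw [numFacets_eq_ncard_tightPotentials hG hc, numFacets_eq_ncard_tightPotentials hH hc',
    ← ncard_tightPotentials_wedge]
  have : Nontrivial (α ⊕ {w : γ // w ≠ v}) := Sum.inl_injective.nontrivial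
  -- The colourings are shifted to agree (with value 0) at the identified vertex.
  refine numFacets_eq_ncard_tightPotentials (wedge_connected hG hH)
    (c := wedgeGlue (fun a => c a - c u) fun w => c' w - c' v) fun x y hxy => ?_
  rcases wedge_adj_iff.1 hxy with ⟨a, b, h, rfl, rfl⟩ | ⟨a, b, h, rfl, rfl⟩
  · have := hc a b h
    simpa [wedgeGlue] using this
  · rw [wedgeGlue_wedgeMap (by simp), wedgeGlue_wedgeMap (by simp)]
    have := hc' a b h
    simpa using this

end Bipartite

/-! ### Even cycles. -/

section Cycle

theorem cycle_adj_iff {n : ℕ} {x y : Fin n} :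
    (cycle n).Adj x y ↔ y = finRotate n x ∨ x = finRotate n y := by
  constructor
  · rintro ⟨e, h | h⟩
    · simp only [Prod.mk.injEq] at h
      exact Or.inl (by rw [← h.1, h.2])
    · simp only [Prod.mk.injEq] at h
      exact Or.inr (by rw [← h.1, h.2])
  · rintro (rfl | rfl)
    · exact ⟨x, Or.inl rfl⟩
    · exact ⟨y, Or.inr rfl⟩

theorem finRotate_val {n : ℕ} (i : Fin n) :
    ((i : ℕ) + 1 < n ∧ (finRotate n i : ℕ) = i + 1) ∨
      ((i : ℕ) + 1 = n ∧ (finRotate n i : ℕ) = 0) := by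
  rcases n with _ | n
  · exact i.elim0
  · rcases Fin.eq_castSucc_or_eq_last i with ⟨j, rfl⟩ | rfl
    · left
      simp
    · right
      simp

theorem cycle_connected {n : ℕ} (u x : Fin n) : ReflTransGen (cycle n).Adj u x := by
  have : Std.Symm (cycle n).Adj := ⟨fun _ _ h => h.symm⟩
  have hn : 0 < n := u.pos
  have h0 : ∀ (l : ℕ) (hl : l < n), ReflTransGen (cycle n).Adj ⟨0, hn⟩ ⟨l, hl⟩ := by
    intro l
    induction l with
    | zero => exact fun _ => ReflTransGen.refl
    | succ l ih =>
      intro hl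
      refine (ih (by omega)).tail (cycle_adj_iff.2 (Or.inl (Fin.ext ?_)))
      rcases finRotate_val (⟨l, by omega⟩ : Fin n) with h | h
      · exact h.2.symm
      · simp only at h
        omega
  exact (symm (h0 u u.2)).trans (h0 x x.2)

theorem cycle_odd {n : ℕ} (hn : Even n) (x y : Fin n) (h : (cycle n).Adj x y) :
    Odd ((x : ℤ) - (y : ℤ)) := by
  obtain ⟨k, hk⟩ := hn
  rcases cycle_adj_iff.1 h with rfl | rfl
  · rcases finRotate_val x with h | h
    · exact ⟨-1, by omega⟩
    · exact ⟨k - 1, by omega⟩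
  · rcases finRotate_val y with h | h
    · exact ⟨0, by omega⟩
    · exact ⟨-k, by omega⟩

/-- Potentials are partial sums of signs around the cycle; the total must vanish for the last edge
to close up. -/
theorem ncard_tightPotentials_cycle {n : ℕ} (hn : 0 < n) :
    (tightPotentials (cycle n) ⟨0, hn⟩).ncard = (stepSet n 0 0).card := by
  rw [← Set.ncard_coe_finset]
  have hrot : ∀ (d : Fin n → ℤ), ∑ i, d i = 0 → ∀ i : Fin n,
      psum d (finRotate n i) = psum d i + d i := by
    intro d hd i
    rw [← psum_succ]
    rcases finRotate_val i with h | h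
    · rw [h.2]
    · rw [h.2, h.1, psum_self, psum_zero, hd]
  symm
  refine Set.ncard_congr (fun d _ i => psum d i) ?_ ?_ ?_
  · intro d hd
    obtain ⟨h1, h2⟩ := mem_stepSet_zero.1 hd
    refine ⟨psum_zero d, fun x y hxy => ?_⟩
    simp only
    rcases cycle_adj_iff.1 hxy with rfl | rfl
    · rw [hrot d h2, abs_sub_comm, add_sub_cancel_left, h1]
    · rw [hrot d h2, add_sub_cancel_left, h1]
  · intro d e hd he h
    have hd2 := hrot d (mem_stepSet_zero.1 hd).2
    have he2 := hrot e (mem_stepSet_zero.1 he).2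
    ext i
    have h3 := congrFun h i
    have h4 := congrFun h (finRotate n i)
    have h5 := hd2 i
    have h6 := he2 i
    omega
  · intro f hf
    have hsum : ∑ i, (f (finRotate n i) - f i) = 0 := by
      rw [Finset.sum_sub_distrib, Equiv.sum_comp (finRotate n) f, sub_self]
    refine ⟨fun i => f (finRotate n i) - f i, ?_, ?_⟩
    · exact mem_stepSet_zero.2 ⟨fun i => hf.2 _ _ (cycle_adj_iff.2 (Or.inr rfl)), hsum⟩
    · ext ⟨l, hl⟩
      induction l with
      | zero => simp only [psum_zero, hf.1]
      | succ l ih =>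
        have h1 := ih (by omega)
        have h2 := psum_succ (fun i => f (finRotate n i) - f i) ⟨l, by omega⟩
        have h3 : finRotate n ⟨l, by omega⟩ = ⟨l + 1, hl⟩ := by
          rcases finRotate_val (⟨l, by omega⟩ : Fin n) with h | h
          · exact Fin.ext h.2
          · simp only at h
            omega
        simp only [h3] at h1 h2
        simp only
        omega

theorem numFacets_cycle {n : ℕ} (hn : 0 < n) (he : Even n) :
    numFacets (cycle n) = n.choose (n / 2) := by
  obtain ⟨k, hk⟩ := he
  have : Nontrivial (Fin n) := Fin.nontrivial_iff_two_le.2 (by omega)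
  rw [numFacets_eq_ncard_tightPotentials (cycle_connected ⟨0, hn⟩) (cycle_odd ⟨k, hk⟩),
    ncard_tightPotentials_cycle, ← card_stepSet_zero]
  congr 2
  omega

theorem numFacets_wedge_cycle {m n : ℕ} (hm : Even m) (hn : Even n) (u : Fin m) (v : Fin n) :
    numFacets (wedge (cycle m) u (cycle n) v) = m.choose (m / 2) * n.choose (n / 2) := by
  have h1 := u.pos
  have h2 := v.pos
  rw [← numFacets_cycle h1 hm, ← numFacets_cycle h2 hn]
  obtain ⟨k, hk⟩ := hm
  obtain ⟨l, hl⟩ := hn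
  have : Nontrivial (Fin m) := Fin.nontrivial_iff_two_le.2 (by omega)
  have : Nontrivial (Fin n) := Fin.nontrivial_iff_two_le.2 (by omega)
  exact numFacets_wedge (cycle_connected u) (cycle_connected v) (cycle_odd ⟨k, hk⟩)
    (cycle_odd ⟨l, hl⟩)

end Cycle

end SymEdge

namespace SymEdge

open Relation

/-! ### Facet potentials on graphs made of parallel paths. -/

section Theta

variable {t : ℕ} {m : Fin t → ℕ}

theorem cbPos_zero (k : Fin t) : cbPos m k 0 = Sum.inl false := by simp [cbPos]

theorem cbPos_last {k : Fin t} (hm : 0 < m k) : cbPos m k (m k) = Sum.inl true := by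
  simp [cbPos, hm.ne']

theorem cbPos_succ {k : Fin t} (i : Fin (m k - 1)) : cbPos m k (i + 1) = Sum.inr ⟨k, i⟩ := by
  simp [cbPos]

theorem exists_cbPos (hm : ∀ k, 0 < m k) (k₀ : Fin t) (x : CBVertex m) :
    ∃ k, ∃ l ≤ m k, x = cbPos m k l := by
  rcases x with (_ | _) | ⟨k, i⟩
  · exact ⟨k₀, 0, Nat.zero_le _, (cbPos_zero k₀).symm⟩
  · exact ⟨k₀, m k₀, le_rfl, (cbPos_last (hm k₀)).symm⟩
  · exact ⟨k, i + 1, by omega, (cbPos_succ i).symm⟩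

/-- The paths meet only at the two endpoints, so these give the only compatibility conditions. -/
theorem exists_forall_cbPos_eq {R : Type*} (φ : Fin t → ℕ → R) (a b : R) (h0 : ∀ k, φ k 0 = a)
    (h1 : ∀ k, φ k (m k) = b) :
    ∃ f : CBVertex m → R, ∀ k, ∀ l ≤ m k, f (cbPos m k l) = φ k l := by
  refine ⟨Sum.elim (fun c => if c then b else a) fun x => φ x.1 (x.2 + 1), fun k l hl => ?_⟩
  unfold cbPos
  split_ifs with h h'
  · simp [h, h0]
  · simp only [Sum.elim_inr]
    congr 1
    omega
  · have : l = m k := by omega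
    simp [this, h1]

theorem CB_adj_iff {x y : CBVertex m} :
    (CB m).Adj x y ↔ ∃ k, ∃ i : Fin (m k), (x = cbPos m k i ∧ y = cbPos m k (i + 1)) ∨
      (y = cbPos m k i ∧ x = cbPos m k (i + 1)) := by
  constructor
  · rintro ⟨⟨k, i⟩, h | h⟩
    · simp only [Prod.mk.injEq] at h
      exact ⟨k, i, Or.inl ⟨h.1.symm, h.2.symm⟩⟩
    · simp only [Prod.mk.injEq] at h
      exact ⟨k, i, Or.inr ⟨h.1.symm, h.2.symm⟩⟩
  · rintro ⟨k, i, ⟨rfl, rfl⟩ | ⟨rfl, rfl⟩⟩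
    · exact ⟨⟨k, i⟩, Or.inl rfl⟩
    · exact ⟨⟨k, i⟩, Or.inr rfl⟩

/-- A relation that holds along the first `l` edges of a path connects its first endpoint to the
vertex at distance `l`. -/
theorem reflTransGen_cbPos {r : CBVertex m → CBVertex m → Prop} (k : Fin t) {l : ℕ}
    (hl : l ≤ m k) (h : ∀ i : Fin (m k), (i : ℕ) < l → r (cbPos m k i) (cbPos m k (i + 1))) :
    ReflTransGen r (Sum.inl false) (cbPos m k l) := by
  induction l with
  | zero => rw [cbPos_zero]
  | succ l ih =>
    exact (ih (by omega) fun i hi => h i (by omega)).tail (h ⟨l, by omega⟩ (Nat.lt_succ_self l))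

theorem reflTransGen_cbPos_of_last {r : CBVertex m → CBVertex m → Prop} {k : Fin t}
    (hm : 0 < m k) {l : ℕ} (hl : l ≤ m k)
    (h : ∀ i : Fin (m k), l ≤ i → r (cbPos m k (i + 1)) (cbPos m k i)) :
    ReflTransGen r (Sum.inl true) (cbPos m k l) := by
  induction hl using Nat.decreasingInduction with
  | self => rw [cbPos_last hm]
  | of_succ l hl ih =>
    exact (ih fun i hi => h i (by omega)).tail (h ⟨l, hl⟩ le_rfl)

theorem CB_connected (hm : ∀ k, 0 < m k) (k₀ : Fin t) (x : CBVertex m) :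
    ReflTransGen (CB m).Adj (Sum.inl false) x := by
  obtain ⟨k, l, hl, rfl⟩ := exists_cbPos hm k₀ x
  exact reflTransGen_cbPos k hl fun i _ => CB_adj_iff.2 ⟨k, i, Or.inl ⟨rfl, rfl⟩⟩

/-- The steps of a potential along the paths. -/
def pathSteps (f : CBVertex m → ℤ) (k : Fin t) (i : Fin (m k)) : ℤ :=
  f (cbPos m k (i + 1)) - f (cbPos m k i)

theorem psum_pathSteps (f : CBVertex m → ℤ) (k : Fin t) {l : ℕ} (hl : l ≤ m k) :
    psum (pathSteps f k) l = f (cbPos m k l) - f (Sum.inl false) := by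
  induction l with
  | zero => rw [psum_zero, cbPos_zero, sub_self]
  | succ l ih =>
    have h := psum_succ (pathSteps f k) ⟨l, hl⟩
    simp only at h
    rw [h, ih (by omega), pathSteps]
    ring

theorem sum_pathSteps (f : CBVertex m → ℤ) {k : Fin t} (hm : 0 < m k) :
    ∑ i, pathSteps f k i = f (Sum.inl true) - f (Sum.inl false) := by
  rw [← psum_self, psum_pathSteps f k le_rfl, cbPos_last hm]

theorem eq_of_pathSteps_eq (hm : ∀ k, 0 < m k) (k₀ : Fin t) {f g : CBVertex m → ℤ}
    (h0 : f (Sum.inl false) = g (Sum.inl false)) (h : pathSteps f = pathSteps g) : f = g := by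
  ext x
  obtain ⟨k, l, hl, rfl⟩ := exists_cbPos hm k₀ x
  have h1 := psum_pathSteps f k hl
  rw [h, psum_pathSteps g k hl] at h1
  omega

theorem exists_pathSteps_eq (d : ∀ k, Fin (m k) → ℤ) {D : ℤ} (hd : ∀ k, ∑ i, d k i = D)
    (k₀ : Fin t) : ∃ f : CBVertex m → ℤ, f (Sum.inl false) = 0 ∧ pathSteps f = d := by
  obtain ⟨f, hf⟩ := exists_forall_cbPos_eq (fun k l => psum (d k) l) 0 D (fun k => psum_zero _)
    fun k => by rw [psum_self, hd]
  refine ⟨f, ?_, ?_⟩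
  · rw [← cbPos_zero k₀, hf _ _ (Nat.zero_le _), psum_zero]
  · ext k i
    rw [pathSteps, hf _ _ i.2, hf _ _ i.2.le, psum_succ, add_sub_cancel_left]

/-- A property of vertices that is invariant along all nonzero steps holds everywhere if it holds
at the root of a facet potential. -/
theorem IsFacetPotential.forall_of_invariant {f : CBVertex m → ℤ}
    (hf : IsFacetPotential (CB m) (Sum.inl false) f) {p : CBVertex m → Prop}
    (h0 : p (Sum.inl false))
    (hp : ∀ k (i : Fin (m k)), pathSteps f k i ≠ 0 →
      (p (cbPos m k i) ↔ p (cbPos m k (i + 1)))) (x) : p x := by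
  induction hf.reach x with
  | refl => exact h0
  | @tail y z _ hyz ih =>
    obtain ⟨k, i, ⟨rfl, rfl⟩ | ⟨rfl, rfl⟩⟩ := CB_adj_iff.1 hyz.1
    · refine (hp k i fun h => ?_).1 ih
      have := hyz.2
      rw [abs_sub_comm] at this
      unfold pathSteps at h
      simp [h] at this
    · refine (hp k i fun h => ?_).2 ih
      have := hyz.2
      unfold pathSteps at h
      simp [h] at this

/-- The stretch between two zero steps of a path would be cut off from the root. -/
theorem IsFacetPotential.card_zero_le_one {f : CBVertex m → ℤ}
    (hf : IsFacetPotential (CB m) (Sum.inl false) f) (k : Fin t) :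
    (Finset.univ.filter fun i => pathSteps f k i = 0).card ≤ 1 := by
  by_contra! hcard
  have : ∃ i j : Fin (m k), i < j ∧ pathSteps f k i = 0 ∧ pathSteps f k j = 0 := by
    obtain ⟨i, hi, j, hj, hij⟩ := Finset.one_lt_card.1 hcard
    simp only [Finset.mem_filter, Finset.mem_univ, true_and] at hi hj
    rcases lt_or_gt_of_ne hij with h | h
    · exact ⟨i, j, h, hi, hj⟩
    · exact ⟨j, i, h, hj, hi⟩
  obtain ⟨i, j, hij, hi, hj⟩ := this
  have hij' : (i : ℕ) < j := hij
  -- `p` is the complement of that stretch, the positions `i + 1, …, j`.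
  obtain ⟨p, hp⟩ := exists_forall_cbPos_eq (m := m)
    (fun k' l => ¬ (k' = k ∧ (i : ℕ) < l ∧ l ≤ j)) True True (fun k' => by simp) fun k' => by
      rw [eq_iff_iff, iff_true]
      rintro ⟨rfl, -, h⟩
      have := j.2
      omega
  have hall := hf.forall_of_invariant (p := p) ?_ ?_ (cbPos m k j)
  · rw [hp k j j.2.le] at hall
    exact hall ⟨rfl, hij', le_rfl⟩
  · rw [← cbPos_zero k, hp k 0 (Nat.zero_le _)]
    simp
  · intro k' l hl
    rw [hp _ _ l.2.le, hp _ _ l.2]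
    by_cases hk : k' = k
    · subst hk
      have h1 : (l : ℕ) ≠ i := fun h => hl (by rw [Fin.ext h, hi])
      have h2 : (l : ℕ) ≠ j := fun h => hl (by rw [Fin.ext h, hj])
      simp only [true_and]
      omega
    · simp [hk]

/-- A zero step on every path would separate the two endpoints. -/
theorem IsFacetPotential.exists_card_zero_eq_zero (hm : ∀ k, 0 < m k) (k₀ : Fin t)
    {f : CBVertex m → ℤ} (hf : IsFacetPotential (CB m) (Sum.inl false) f) :
    ∃ k, (Finset.univ.filter fun i => pathSteps f k i = 0).card = 0 := by
  by_contra! h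
  have hex : ∀ k, ∃ i, pathSteps f k i = 0 := by
    intro k
    obtain ⟨i, hi⟩ := Finset.card_ne_zero.1 (h k)
    exact ⟨i, (Finset.mem_filter.1 hi).2⟩
  choose c hc using hex
  obtain ⟨p, hp⟩ := exists_forall_cbPos_eq (m := m) (fun k l => l ≤ (c k : ℕ)) True False
    (fun k => by simp) fun k => by
      have := (c k).2
      simp
  have hall := hf.forall_of_invariant (p := p) ?_ ?_ (Sum.inl true)
  · rw [← cbPos_last (hm k₀), hp k₀ _ le_rfl] at hall
    have := (c k₀).2
    omega
  · rw [← cbPos_zero k₀, hp k₀ 0 (Nat.zero_le _)]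
    exact Nat.zero_le _
  · intro k l hl
    rw [hp _ _ l.2.le, hp _ _ l.2]
    have h1 : (l : ℕ) ≠ c k := fun h => hl (by rw [Fin.ext h, hc])
    omega

/-- The zero-free path joins the two endpoints. Any other vertex is reached along its own path from
an endpoint on its side of the zero step. -/
theorem isFacetPotential_of_steps (hm : ∀ k, 0 < m k) {f : CBVertex m → ℤ}
    (h0 : f (Sum.inl false) = 0) (hle : ∀ k i, |pathSteps f k i| ≤ 1)
    (hone : ∀ k, (Finset.univ.filter fun i => pathSteps f k i = 0).card ≤ 1)
    {k₀ : Fin t} (hk₀ : (Finset.univ.filter fun i => pathSteps f k₀ i = 0).card = 0) :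
    IsFacetPotential (CB m) (Sum.inl false) f := by
  have hstep : ∀ k i, pathSteps f k i ≠ 0 →
      (CB m).Adj (cbPos m k i) (cbPos m k (i + 1)) ∧
        |f (cbPos m k i) - f (cbPos m k (i + 1))| = 1 := by
    intro k i hi
    refine ⟨CB_adj_iff.2 ⟨k, i, Or.inl ⟨rfl, rfl⟩⟩, ?_⟩
    rw [abs_sub_comm]
    exact le_antisymm (hle k i) (Int.one_le_abs hi)
  have hstep' : ∀ k i, pathSteps f k i ≠ 0 →
      (CB m).Adj (cbPos m k (i + 1)) (cbPos m k i) ∧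
        |f (cbPos m k (i + 1)) - f (cbPos m k i)| = 1 := by
    intro k i hi
    refine ⟨(hstep k i hi).1.symm, ?_⟩
    rw [abs_sub_comm]
    exact (hstep k i hi).2
  refine ⟨h0, fun x y hxy => ?_, fun x => ?_⟩
  · obtain ⟨k, i, ⟨rfl, rfl⟩ | ⟨rfl, rfl⟩⟩ := CB_adj_iff.1 hxy
    · rw [abs_sub_comm]
      exact hle k i
    · exact hle k i
  · have htrue : ReflTransGen
        (fun x y => (CB m).Adj x y ∧ |f x - f y| = 1) (Sum.inl false) (Sum.inl true) := by
      rw [← cbPos_last (hm k₀)]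
      refine reflTransGen_cbPos k₀ le_rfl fun i _ => hstep k₀ i fun hi => ?_
      rw [Finset.card_eq_zero, Finset.filter_eq_empty_iff] at hk₀
      exact hk₀ (Finset.mem_univ i) hi
    obtain ⟨k, l, hl, rfl⟩ := exists_cbPos hm k₀ x
    by_cases hz : ∀ i : Fin (m k), (i : ℕ) < l → pathSteps f k i ≠ 0
    · exact reflTransGen_cbPos k hl fun i hi => hstep k i (hz i hi)
    · push Not at hz
      obtain ⟨j, hj, hj0⟩ := hz
      refine htrue.trans (reflTransGen_cbPos_of_last (hm k) hl fun i hi => hstep' k i fun hi0 => ?_)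
      have := Finset.card_le_one.1 (hone k) i (by simp [hi0]) j (by simp [hj0])
      rw [this] at hi
      omega

/-- The step sequences on the paths that come from facet potentials: every path has at most one
zero step, some path has none, and all paths have the same sum. -/
noncomputable def facetSteps (m : Fin t → ℕ) (M : ℕ) : Finset (∀ k, Fin (m k) → ℤ) :=
  ((Finset.univ.filter fun z : Fin t → Fin 2 => ∃ k, z k = 0) ×ˢ
    Finset.Icc (-M : ℤ) M).biUnion
      fun x => Fintype.piFinset fun k => stepSet (m k) (x.1 k) x.2

/-- The bound `M` only makes the range of common sums finite; no sum exceeds a path length in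
absolute value. -/
theorem mem_facetSteps {M : ℕ} (hM : ∀ k, m k ≤ M) {d : ∀ k, Fin (m k) → ℤ} :
    d ∈ facetSteps m M ↔ (∀ k i, |d k i| ≤ 1) ∧
      (∀ k, (Finset.univ.filter fun i => d k i = 0).card ≤ 1) ∧
      (∃ k, (Finset.univ.filter fun i => d k i = 0).card = 0) ∧
      ∃ D, ∀ k, ∑ i, d k i = D := by
  simp only [facetSteps, Finset.mem_biUnion, Finset.mem_product, Finset.mem_filter,
    Finset.mem_univ, true_and, Finset.mem_Icc, Fintype.mem_piFinset, Prod.exists]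
  constructor
  · rintro ⟨z, D, ⟨⟨k, hk⟩, -⟩, hd⟩
    have h := fun k => mem_stepSet.1 (hd k)
    refine ⟨fun k => (h k).1, fun k => ?_, ⟨k, ?_⟩, D, fun k => (h k).2.2⟩
    · rw [(h k).2.1]
      omega
    · rw [(h k).2.1, hk]
      rfl
  · rintro ⟨h1, h2, ⟨k, hk⟩, D, hD⟩
    have hmem : ∀ k, d k ∈ stepSet (m k)
        ((⟨(Finset.univ.filter fun i => d k i = 0).card, Nat.lt_succ_of_le (h2 k)⟩ : Fin 2) : ℕ) D :=
      fun k => mem_stepSet.2 ⟨h1 k, rfl, hD k⟩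
    refine ⟨_, D, ⟨⟨k, Fin.ext hk⟩, ?_⟩, hmem⟩
    have := abs_le_of_mem_stepSet (hmem k)
    rw [abs_le] at this
    have := hM k
    omega

/-- The union is disjoint since the steps determine the zero pattern and the common sum; `k₀`
supplies a path on which to read the sum. -/
theorem card_facetSteps (M : ℕ) (k₀ : Fin t) :
    (facetSteps m M).card = ∑ z : Fin t → Fin 2 with ∃ k, z k = 0,
      ∑ D ∈ Finset.Icc (-M : ℤ) M, ∏ k, (stepSet (m k) (z k) D).card := by
  rw [facetSteps, Finset.card_biUnion, Finset.sum_product]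
  · simp only [Fintype.card_piFinset]
  · rintro ⟨z, D⟩ - ⟨z', D'⟩ - hne
    rw [Function.onFun, Finset.disjoint_left]
    intro d hd hd'
    rw [Fintype.mem_piFinset] at hd hd'
    have h := fun k => (mem_stepSet.1 (hd k)).2
    have h' := fun k => (mem_stepSet.1 (hd' k)).2
    refine hne (Prod.ext (funext fun k => Fin.ext ?_) ?_)
    · exact (h k).1.symm.trans (h' k).1
    · exact (h k₀).2.symm.trans (h' k₀).2

theorem numFacets_CB (hm : ∀ k, 0 < m k) (k₀ : Fin t) {M : ℕ} (hM : ∀ k, m k ≤ M) :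
    numFacets (CB m) = ∑ z : Fin t → Fin 2 with ∃ k, z k = 0,
      ∑ D ∈ Finset.Icc (-M : ℤ) M, ∏ k, (stepSet (m k) (z k) D).card := by
  have : Nontrivial (CBVertex m) := Sum.inl_injective.nontrivial
  rw [numFacets_eq_ncard (CB_connected hm k₀), ← card_facetSteps M k₀, ← Set.ncard_coe_finset]
  refine Set.ncard_congr (fun f _ => pathSteps f) ?_ ?_ ?_
  · intro f hf
    refine (mem_facetSteps hM).2 ⟨fun k i => ?_, hf.card_zero_le_one,
      hf.exists_card_zero_eq_zero hm k₀, _, fun k => sum_pathSteps f (hm k)⟩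
    exact hf.abs_le _ _ (CB_adj_iff.2 ⟨k, i, Or.inr ⟨rfl, rfl⟩⟩)
  · intro f g hf hg h
    exact eq_of_pathSteps_eq hm k₀ (hf.root.trans hg.root.symm) h
  · intro d hd
    obtain ⟨h1, h2, ⟨k, hk⟩, D, hD⟩ := (mem_facetSteps hM).1 hd
    obtain ⟨f, hf0, rfl⟩ := exists_pathSteps_eq d hD k₀
    exact ⟨f, isFacetPotential_of_steps hm hf0 h1 h2 hk, rfl⟩

end Theta

/-! ### Evaluating the sum over `D` for a fixed zero pattern. -/

section Count

/-- The number of tuples of sequences of signs, of the given lengths, with equal sums. -/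
theorem sum_prod_card_stepSet {t : ℕ} (n : Fin (t + 1) → ℕ) {M : ℕ} (hM : ∀ k, n k ≤ M)
    (hpar : ∀ k l, Even (n k + n l)) :
    ∑ D ∈ Finset.Icc (-M : ℤ) M, ∏ k, (stepSet (n k) 0 D).card = F n := by
  obtain ⟨k₀, -, hk₀⟩ := Finset.exists_mem_eq_inf' Finset.univ_nonempty n
  have hmin : ∀ k, n k₀ ≤ n k := fun k => hk₀ ▸ Finset.inf'_le n (Finset.mem_univ k)
  simp only [F]
  rw [hk₀]
  symm
  have hM₀ := hM k₀
  -- `j` counts the `+1` steps on a shortest path.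
  refine Finset.sum_of_injOn (fun j : ℕ => (2 * j - n k₀ : ℤ)) ?_ ?_ ?_ ?_
  · intro i _ j _ h
    simp only at h
    omega
  · intro j hj
    simp only [Finset.coe_range, Set.mem_Iio, Finset.coe_Icc, Set.mem_Icc] at hj ⊢
    omega
  -- Any other `D` has the wrong parity or is too large for the shortest path, whose factor is then
  -- zero.
  · intro D _ hD
    rw [Finset.prod_eq_zero (Finset.mem_univ k₀)]
    rw [Finset.card_eq_zero]
    by_contra hne
    rw [← ne_eq, ← Finset.nonempty_iff_ne_empty] at hne
    obtain ⟨a, ha⟩ := even_add_of_stepSet_nonempty hne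
    obtain ⟨d, hd⟩ := hne
    have hle := abs_le.1 (abs_le_of_mem_stepSet hd)
    refine hD ⟨a.toNat, ?_, ?_⟩
    · simp only [Finset.coe_range, Set.mem_Iio]
      omega
    · simp only
      omega
  · intro j _
    refine Finset.prod_congr rfl fun k _ => ?_
    -- With `s = n k₀`, the sum `2 * j - s` on path `k` needs `(n k - s) / 2 + j` steps `+1`; equal
    -- parity makes the division exact.
    rw [← card_stepSet_zero]
    congr 2
    obtain ⟨a, ha⟩ := hpar k k₀
    have := hmin k
    push_cast
    omega

/-- A nonempty step set forces `D` to have the parity of `m k + z k`, which cannot hold for two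
paths of different parity. -/
theorem sum_prod_card_stepSet_eq_zero {t : ℕ} (m : Fin t → ℕ) (z : Fin t → Fin 2)
    (hm : ∀ k, 0 < m k) (s : Finset ℤ) {k l : Fin t}
    (hpar : ¬ Even (m k + z k + (m l + z l))) :
    ∑ D ∈ s, ∏ k, (stepSet (m k) (z k) D).card = 0 := by
  have key : ∀ k D, (stepSet (m k) (z k) D).card ≠ 0 → Even (D + m k + z k) := by
    intro k D h
    obtain ⟨a, ha⟩ : ∃ a, m k = a + 1 := ⟨m k - 1, by have := hm k; omega⟩
    have hz : z k = 0 ∨ z k = 1 := by omega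
    rcases hz with hz | hz
    · rw [hz] at h ⊢
      simpa using even_add_of_stepSet_nonempty (Finset.card_ne_zero.1 h)
    · rw [ha, hz, Fin.val_one, card_stepSet_one] at h
      obtain ⟨b, hb⟩ := even_add_of_stepSet_nonempty
        (Finset.card_ne_zero.1 (right_ne_zero_of_mul h))
      rw [ha, hz]
      exact ⟨b + 1, by push_cast; simp only [Fin.isValue, Fin.val_one]; push_cast; omega⟩
  refine Finset.sum_eq_zero fun D _ => ?_
  by_contra h
  rw [← ne_eq, Finset.prod_ne_zero_iff] at h
  obtain ⟨a, ha⟩ := key k D (h k (Finset.mem_univ k))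
  obtain ⟨b, hb⟩ := key l D (h l (Finset.mem_univ l))
  exact hpar ⟨(a + b - D).toNat, by omega⟩

/-- Each path with a zero step contributes a factor `m k` for its position and is shortened by one.
-/
theorem sum_prod_card_stepSet_eq_mul {t : ℕ} (m : Fin (t + 1) → ℕ) (z : Fin (t + 1) → Fin 2)
    (hm : ∀ k, 0 < m k) {M : ℕ} (hM : ∀ k, m k ≤ M)
    (hpar : ∀ k l, Even (m k + z k + (m l + z l))) :
    ∑ D ∈ Finset.Icc (-M : ℤ) M, ∏ k, (stepSet (m k) (z k) D).card =
      (∏ k, m k ^ (z k : ℕ)) * F fun k => m k - z k := by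
  rw [← sum_prod_card_stepSet (M := M), Finset.mul_sum]
  · refine Finset.sum_congr rfl fun D _ => ?_
    rw [← Finset.prod_mul_distrib]
    refine Finset.prod_congr rfl fun k _ => ?_
    obtain ⟨a, ha⟩ : ∃ a, m k = a + 1 := ⟨m k - 1, by have := hm k; omega⟩
    have hz : z k = 0 ∨ z k = 1 := by omega
    rcases hz with hz | hz
    · have h0 : m k - z k = m k := by simp [hz]
      rw [h0, hz, Fin.val_zero, pow_zero, one_mul]
    · rw [ha, hz, Fin.val_one, card_stepSet_one, pow_one, Nat.add_sub_cancel]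
  · exact fun k => (Nat.sub_le _ _).trans (hM k)
  · intro k l
    obtain ⟨a, ha⟩ := hpar k l
    have h1 := hm k
    have h2 := hm l
    have h3 : (z k : ℕ) < 2 := (z k).2
    have h4 : (z l : ℕ) < 2 := (z l).2
    exact ⟨a - z k - z l, by omega⟩

end Count

end SymEdge

namespace SymEdge

/-! ### Three paths. -/

section Three

/-- The contribution to the number of facets of the step sequences that have one zero step on the
`k`-th path when `z k = 1` and none when `z k = 0`. -/
def thetaTerm (a b c i j k : ℕ) : ℕ :=
  if (a + i) % 2 = (b + j) % 2 ∧ (a + i) % 2 = (c + k) % 2 then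
    a ^ i * b ^ j * c ^ k * F ![a - i, b - j, c - k]
  else 0

theorem sum_prod_card_stepSet_three {a b c M : ℕ} (ha : 0 < a) (hb : 0 < b) (hc : 0 < c)
    (hM : ∀ k, ![a, b, c] k ≤ M) (i j k : Fin 2) :
    ∑ D ∈ Finset.Icc (-M : ℤ) M,
      ∏ l, (stepSet (![a, b, c] l) (![i, j, k] l) D).card = thetaTerm a b c i j k := by
  have hm : ∀ l, 0 < ![a, b, c] l := by
    intro l
    fin_cases l <;> assumption
  unfold thetaTerm
  split_ifs with h
  · rw [sum_prod_card_stepSet_eq_mul _ _ hm hM]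
    · congr 1
      simp [Fin.prod_univ_three]
    · intro p q
      fin_cases p <;> fin_cases q <;> simp [Nat.even_iff] <;> omega
  · by_cases h1 : (a + i) % 2 = (b + j) % 2
    · refine sum_prod_card_stepSet_eq_zero _ _ hm _ (k := 0) (l := 2) ?_
      simp [Nat.even_iff]
      omega
    · refine sum_prod_card_stepSet_eq_zero _ _ hm _ (k := 0) (l := 1) ?_
      simp [Nat.even_iff]
      omega

theorem numFacets_CB_three {a b c : ℕ} (ha : 0 < a) (hb : 0 < b) (hc : 0 < c) :
    numFacets (CB ![a, b, c]) = thetaTerm a b c 0 0 0 + thetaTerm a b c 0 0 1 +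
      thetaTerm a b c 0 1 0 + thetaTerm a b c 1 0 0 + thetaTerm a b c 0 1 1 +
      thetaTerm a b c 1 0 1 + thetaTerm a b c 1 1 0 := by
  have hM : ∀ k, ![a, b, c] k ≤ a + b + c := by
    intro k
    fin_cases k <;> simp <;> omega
  have hm : ∀ l, 0 < ![a, b, c] l := by
    intro l
    fin_cases l <;> assumption
  -- Only the pattern with a zero step on all three paths is excluded.
  have hz : (Finset.univ.filter fun z : Fin 3 → Fin 2 => ∃ k, z k = 0) =
      {![0, 0, 0], ![0, 0, 1], ![0, 1, 0], ![1, 0, 0], ![0, 1, 1], ![1, 0, 1], ![1, 1, 0]} := by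
    decide
  rw [numFacets_CB hm 0 hM, hz]
  iterate 6 rw [Finset.sum_insert (by decide)]
  rw [Finset.sum_singleton]
  iterate 7 rw [sum_prod_card_stepSet_three ha hb hc hM]
  simp only [Fin.val_zero, Fin.val_one, add_assoc]

/-- Only `j = 0` remains; for even `a`, `b` this is the count for a wedge of two cycles. -/
theorem F_zero_right (a b : ℕ) : F ![a, b, 0] = a.choose (a / 2) * b.choose (b / 2) := by
  have hmin : Finset.univ.inf' Finset.univ_nonempty ![a, b, 0] = 0 :=
    Nat.le_zero.1 (Finset.inf'_le ![a, b, 0] (Finset.mem_univ 2))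
  simp [F, hmin, Fin.prod_univ_three]

theorem F_zero_zero (a : ℕ) : F ![a, 0, 0] = a.choose (a / 2) := by
  simp [F_zero_right]

end Three

end SymEdge

/-! ### Selecting the surviving zero patterns by parity. -/

theorem mainTheorem8 :
    -- (i) all even or all odd
    (∀ x₁ x₂ x₃ : ℕ, 0 < x₁ → 0 < x₂ → 0 < x₃ →
      ((Even x₁ ∧ Even x₂ ∧ Even x₃) ∨ (Odd x₁ ∧ Odd x₂ ∧ Odd x₃)) →
      SymEdge.numFacets (SymEdge.CB ![x₁, x₂, x₃]) = SymEdge.F ![x₁, x₂, x₃]) ∧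
    -- (ii) two odd, one even, all at least 2
    (∀ o₁ o₂ e₁ : ℕ, Odd o₁ → Odd o₂ → Even e₁ → 2 ≤ o₁ → 2 ≤ o₂ → 2 ≤ e₁ →
      SymEdge.numFacets (SymEdge.CB ![o₁, o₂, e₁]) =
        e₁ * SymEdge.F ![o₁, o₂, e₁ - 1] + o₁ * o₂ * SymEdge.F ![o₁ - 1, o₂ - 1, e₁]) ∧
    -- (ii) two even, one odd, all at least 2
    (∀ e₁ e₂ o₁ : ℕ, Even e₁ → Even e₂ → Odd o₁ → 2 ≤ e₁ → 2 ≤ e₂ → 2 ≤ o₁ →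
      SymEdge.numFacets (SymEdge.CB ![e₁, e₂, o₁]) =
        o₁ * SymEdge.F ![e₁, e₂, o₁ - 1] + e₁ * e₂ * SymEdge.F ![e₁ - 1, e₂ - 1, o₁]) ∧
    -- (iii) two even, one path of length 1; the cycles may be joined at any vertices
    (∀ e₁ e₂ : ℕ, Even e₁ → Even e₂ → 0 < e₁ → 0 < e₂ →
      ∀ (u : Fin e₁) (v : Fin e₂),
      SymEdge.numFacets (SymEdge.CB ![e₁, e₂, 1]) =
        e₁ * e₂ * SymEdge.F ![e₁ - 1, e₂ - 1, 1] +
          SymEdge.numFacets (SymEdge.wedge (SymEdge.cycle e₁) u (SymEdge.cycle e₂) v)) ∧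
    -- (iv) one even, one odd and at least 3, one path of length 1
    (∀ e₁ o₁ : ℕ, Even e₁ → 0 < e₁ → Odd o₁ → 3 ≤ o₁ →
      ∀ (u : Fin (o₁ - 1)) (v : Fin e₁),
      SymEdge.numFacets (SymEdge.CB ![e₁, o₁, 1]) =
        e₁ * SymEdge.F ![e₁ - 1, o₁, 1] +
          o₁ * SymEdge.numFacets
            (SymEdge.wedge (SymEdge.cycle (o₁ - 1)) u (SymEdge.cycle e₁) v)) ∧
    -- (v) one even, two paths of length 1
    (∀ e₁ : ℕ, Even e₁ → 0 < e₁ →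
      SymEdge.numFacets (SymEdge.CB ![e₁, 1, 1]) =
        e₁ * SymEdge.F ![e₁ - 1, 1, 1] + SymEdge.numFacets (SymEdge.cycle e₁)) := by
  refine ⟨?_, ?_, ?_, ?_, ?_, ?_⟩
  · intro a b c ha hb hc h
    have h' : a % 2 = b % 2 ∧ b % 2 = c % 2 := by
      rcases h with ⟨h1, h2, h3⟩ | ⟨h1, h2, h3⟩
      · rw [Nat.even_iff] at h1 h2 h3
        omega
      · rw [Nat.odd_iff] at h1 h2 h3
        omega
    rw [SymEdge.numFacets_CB_three ha hb hc]
    unfold SymEdge.thetaTerm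
    -- Only the pattern without zero steps preserves the common parity.
    rw [if_pos (by omega), if_neg (by omega), if_neg (by omega), if_neg (by omega),
      if_neg (by omega), if_neg (by omega), if_neg (by omega)]
    simp
  · intro a b c h1 h2 h3 ha hb hc
    rw [Nat.odd_iff] at h1 h2
    rw [Nat.even_iff] at h3
    rw [SymEdge.numFacets_CB_three (by omega) (by omega) (by omega)]
    unfold SymEdge.thetaTerm
    -- Equal parity is reached by shortening either the one exceptional path or both of the others.
    rw [if_neg (by omega), if_pos (by omega), if_neg (by omega), if_neg (by omega),
      if_neg (by omega), if_neg (by omega), if_pos (by omega)]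
    simp
  · intro a b c h1 h2 h3 ha hb hc
    rw [Nat.even_iff] at h1 h2
    rw [Nat.odd_iff] at h3
    rw [SymEdge.numFacets_CB_three (by omega) (by omega) (by omega)]
    unfold SymEdge.thetaTerm
    rw [if_neg (by omega), if_pos (by omega), if_neg (by omega), if_neg (by omega),
      if_neg (by omega), if_neg (by omega), if_pos (by omega)]
    simp
  · intro a b h1 h2 ha hb u v
    rw [SymEdge.numFacets_wedge_cycle h1 h2, ← SymEdge.F_zero_right]
    rw [Nat.even_iff] at h1 h2
    rw [SymEdge.numFacets_CB_three ha hb one_pos]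
    unfold SymEdge.thetaTerm
    -- The zero step on the path of length 1 leaves length 0, which is the wedge term.
    rw [if_neg (by omega), if_pos (by omega), if_neg (by omega), if_neg (by omega),
      if_neg (by omega), if_neg (by omega), if_pos (by omega)]
    simp [add_comm]
  · intro a b h1 ha h2 hb u v
    rw [SymEdge.numFacets_wedge_cycle (Nat.Odd.sub_odd h2 odd_one) h1, mul_comm (Nat.choose _ _),
      ← SymEdge.F_zero_right]
    rw [Nat.even_iff] at h1
    rw [Nat.odd_iff] at h2
    rw [SymEdge.numFacets_CB_three ha (by omega) one_pos]
    unfold SymEdge.thetaTerm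
    -- The even path is the exceptional one; shortening both odd paths gives the wedge term.
    rw [if_neg (by omega), if_neg (by omega), if_neg (by omega), if_pos (by omega),
      if_pos (by omega), if_neg (by omega), if_neg (by omega)]
    simp
  · intro a h1 ha
    rw [SymEdge.numFacets_cycle ha h1, ← SymEdge.F_zero_zero]
    rw [Nat.even_iff] at h1
    rw [SymEdge.numFacets_CB_three ha one_pos one_pos]
    unfold SymEdge.thetaTerm
    rw [if_neg (by omega), if_neg (by omega), if_neg (by omega), if_pos (by omega),
      if_pos (by omega), if_neg (by omega), if_neg (by omega)]
    simp
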